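/- Let $Z$ be a smooth manifold of dimension $n+m$ and $i : X \hookrightarrow Z$ an embedded smooth submanifold of dimension $n$. Let $J^2(Z)\to Z$ be the bundle of 2-jets of functions, with fibre $J^2_z(Z)$ the germs of smooth functions at $z$ modulo those vanishing to order three; every function $\varphi$ that is $C^2$ near $z$ has a 2-jet $J^2_z\varphi \in J^2_z(Z)$, and local coordinates identify $J^2_z(Z)$ with $\mathbf R\times\mathbf R^{n+m}\times \mathrm{Sym}^2(\mathbf R^{n+m})$ by $J^2_z\varphi=(\varphi(z),D\varphi(z),D^2\varphi(z))$. A *subequation* on $Z$ is a closed set $F\subset J^2(Z)$ such that, fibrewise, $F+\mathcal P\subset F$ and $F+\mathcal N\subset F$, where $\mathcal P$ is the set of 2-jets of functions with critical value zero and non-negative second derivative and $\mathcal N$ the set of 2-jets of constants $\le 0$, and such that $F=\overline{\mathrm{Int} F}$, $F_z=\overline{\mathrm{Int} F_z}$ and $\mathrm{Int} F_z=(\mathrm{Int} F)_z$ for all $z$. For a manifold $M$ and a set $G\subset J^2(M)$, an upper semicontinuous function $u:M\to[-\infty,\infty)$ is *$G$-subharmonic* if $J^2_z\varphi\in G$ for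 every $z\in M$ and every function $\varphi$, $C^2$ near $z$, with $u\le\varphi$ near $z$ and $u(z)=\varphi(z)$. Let $i^*F\subset J^2(X)$ be the set of restrictions to $X$ of the 2-jets in $F$ at points of $X$, that is, $(i^*F)_x=\{J^2_x(f|_X) : f \text{ is } C^2 \text{ near } x \text{ in } Z,\ J^2_xf\in F_x\}$. Let $F$ be a subequation on $Z$ that satisfies the following *Restriction Hypothesis*: around each point of $X$ there are smooth local coordinates $z=(x,y)\in\mathbf R^n\times\mathbf R^m$ on $Z$ in which $X$ is given by $y=y_0$, such that for every point $(x_0,y_0)$ of $X$ in the coordinate neighbourhood, every $(r_0,p_0,A_0)\in\mathbf R\times\mathbf R^n\times\mathrm{Sym}^2(\mathbf R^n)$, every sequence of numbers $\epsilon>0$ converging to $0$, and all $z_\epsilon=(x_\epsilon,y_\epsilon)$ in the coordinate neighbourhood and $r_\epsilon\in\mathbf R$: if $$\left(r_\epsilon,\ \Big(p_0+A_0(x_\epsilon-x_0),\ \frac{y_\epsilon-y_0}{\epsilon}\Big),\ \begin{pmatrix}A_0&0\\0&\frac1\epsilon I\end{pmatrix}\right)\in F_{z_\epsilon}\ \text{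 for all } \epsilon,$$ $$x_\epsilon\to x_0,\qquad \frac{|y_\epsilon-y_0|^2}{\epsilon}\to0,\qquad r_\epsilon\to r_0,$$ then $(r_0,p_0,A_0)\in(i^*F)_{x_0}$ (in the coordinates $x$ on $X$). Let $u:Z\to[-\infty,\infty)$ be upper semicontinuous and $F$-subharmonic on $Z$. If $i^*F$ is closed in $J^2(X)$, then $u|_X$ is $i^*F$-subharmonic on $X$. If $i^*F$ is not closed, then $u|_X$ is $\overline{i^*F}$-subharmonic on $X$, where $\overline{i^*F}$ is the closure of $i^*F$ in $J^2(X)$. -/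

import Mathlib

open Set Filter Topology Manifold
open scoped ContDiff

namespace ViscosityRestriction

theorem two_le_infty : (2 : WithTop ℕ∞) ≤ ∞ :=
  WithTop.coe_le_coe.2 (le_top : (2 : ℕ∞) ≤ ⊤)

/-! ## Coordinates and 2-jets

`M` is a manifold without boundary modelled on the normed space `E`. -/

section Jets

variable (E : Type*) [NormedAddCommGroup E] [NormedSpace ℝ E]
variable {M : Type*} [TopologicalSpace M] [ChartedSpace E M]
variable {V : Type*} [NormedAddCommGroup V] [NormedSpace ℝ V]

/-- A smooth local coordinate system on `M` with values in `V`: a diffeomorphism of an open subset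
of `M` onto an open subset of `V`. -/
def IsCoordinates (e : OpenPartialHomeomorph M V) : Prop :=
  ContMDiffOn 𝓘(ℝ, E) 𝓘(ℝ, V) ∞ e e.source ∧ ContMDiffOn 𝓘(ℝ, V) 𝓘(ℝ, E) ∞ e.symm e.target

/-- The symmetric bilinear forms on `V`. -/
def Sym2Form (V : Type*) [NormedAddCommGroup V] [NormedSpace ℝ V] :
    Submodule ℝ (V →L[ℝ] V →L[ℝ] ℝ) where
  carrier := {A | ∀ v w, A v w = A w v}
  add_mem' {A B} hA hB v w := by simp [hA v w, hB v w]
  zero_mem' v w := by simp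
  smul_mem' c A hA v w := by simp [hA v w]

/-- The functions that are `C²` near `z`. -/
def C2At (z : M) : Submodule ℝ (M → ℝ) where
  carrier := {f | ContMDiffAt 𝓘(ℝ, E) 𝓘(ℝ, ℝ) 2 f z}
  add_mem' hf hg := ContMDiffAt.add hf hg
  zero_mem' := contMDiffAt_const
  smul_mem' c _ hf :=
    ((contDiff_const_smul (𝕜 := ℝ) (F := ℝ) (n := 2) c).contMDiff.contMDiffAt).comp z hf

/-- The functions, `C²` near `z`, that vanish at `z` to higher than second order. -/
def VanishingAt (z : M) : Submodule ℝ (C2At E z) where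
  carrier := {f | (f : M → ℝ) =o[𝓝 z] fun w => ‖chartAt E z w - chartAt E z z‖ ^ 2}
  add_mem' hf hg := hf.add hg
  zero_mem' := Asymptotics.isLittleO_zero _ _
  smul_mem' c _ hf := hf.const_smul_left c

/-- The space of 2-jets of functions at `z`. Each class contains a smooth function (a quadratic
polynomial in local coordinates), and two smooth functions are in the same class exactly when their
difference vanishes to order three at `z`; so these are also the germs of smooth functions modulo
those vanishing to order three. -/
def JetAt (z : M) : Type _ := C2At E z ⧸ VanishingAt E z

instance (z : M) : AddCommGroup (JetAt E z) :=
  inferInstanceAs (AddCommGroup (C2At E z ⧸ VanishingAt E z))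

instance (z : M) : Module ℝ (JetAt E z) :=
  inferInstanceAs (Module ℝ (C2At E z ⧸ VanishingAt E z))

variable (M) in
/-- The total space of the bundle of 2-jets of functions on `M`. -/
structure JetBundle where
  /-- the base point -/
  base : M
  /-- the 2-jet at the base point -/
  jet : JetAt E base

/-- The 2-jet at `z` of a function that is `C²` near `z`. -/
def jet2 (f : M → ℝ) (z : M) (hf : ContMDiffAt 𝓘(ℝ, E) 𝓘(ℝ, ℝ) 2 f z) : JetAt E z :=
  Submodule.Quotient.mk (p := VanishingAt E z) ⟨f, hf⟩

/-- The quadratic polynomial, in the coordinates `e` centred at `z`, with value `r`, first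
derivative `p` and second derivative `A` at `z`. -/
noncomputable def quad (e : OpenPartialHomeomorph M V) (z : M) (r : ℝ) (p : V →L[ℝ] ℝ)
    (A : Sym2Form V) (w : M) : ℝ :=
  r + p (e w - e z) + (1 / 2) * A.1 (e w - e z) (e w - e z)

variable {E}

theorem IsCoordinates.contMDiffAt_quad {e : OpenPartialHomeomorph M V} (he : IsCoordinates E e)
    {z : M} (hz : z ∈ e.source) (r : ℝ) (p : V →L[ℝ] ℝ) (A : Sym2Form V) :
    ContMDiffAt 𝓘(ℝ, E) 𝓘(ℝ, ℝ) 2 (quad e z r p A) z := by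
  have h1 : ContMDiffAt 𝓘(ℝ, E) 𝓘(ℝ, V) 2 e z :=
    (he.1.contMDiffAt (e.open_source.mem_nhds hz)).of_le two_le_infty
  have h2 : ContDiff ℝ 2 fun v : V =>
      r + p (v - e z) + (1 / 2) * A.1 (v - e z) (v - e z) := by
    fun_prop
  exact h2.contMDiff.contMDiffAt.comp z h1

/-- The 2-jet at `z` whose components in the coordinates `e` are `(r, p, A)`. -/
noncomputable def coordJet {e : OpenPartialHomeomorph M V} (he : IsCoordinates E e) {z : M}
    (hz : z ∈ e.source) (r : ℝ) (p : V →L[ℝ] ℝ) (A : Sym2Form V) : JetAt E z :=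
  jet2 E (quad e z r p A) z (he.contMDiffAt_quad hz r p A)

/-- The topology of the 2-jet bundle: the finest one for which all the coordinate
parametrizations `U × ℝ × E* × Sym²(E*) → J²(M)` are continuous. Coordinate changes being
homeomorphisms, each of these parametrizations is a homeomorphism onto the open set `J²(U)`. -/
noncomputable instance : TopologicalSpace (JetBundle E M) :=
  ⨆ (e : OpenPartialHomeomorph M E) (he : IsCoordinates E e),
    TopologicalSpace.coinduced
      (fun q : e.source × ℝ × (E →L[ℝ] ℝ) × Sym2Form E =>
        (⟨q.1, coordJet he q.1.2 q.2.1 q.2.2.1 q.2.2.2⟩ : JetBundle E M))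
      inferInstance

/-- The fibre over `z` of a subset of the 2-jet bundle. -/
def fibre (F : Set (JetBundle E M)) (z : M) : Set (JetAt E z) :=
  {j | (⟨z, j⟩ : JetBundle E M) ∈ F}

/-- The topology of the fibre `J²_z(M)`, as a subspace of the 2-jet bundle. -/
noncomputable instance (z : M) : TopologicalSpace (JetAt E z) :=
  TopologicalSpace.induced (fun j => (⟨z, j⟩ : JetBundle E M)) inferInstance

/-- The jets of functions with critical value zero and non-negative second derivative
(a condition that does not depend on the coordinates). -/
def positiveJets (z : M) : Set (JetAt E z) :=
  {j | ∃ (e : OpenPartialHomeomorph M E) (he : IsCoordinates E e) (hz : z ∈ e.source)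
    (A : Sym2Form E), (∀ v, 0 ≤ A.1 v v) ∧ j = coordJet he hz 0 0 A}

/-- The jets of the non-positive constant functions. -/
def negativeJets (z : M) : Set (JetAt E z) :=
  {j | ∃ r : ℝ, r ≤ 0 ∧ j = jet2 E (fun _ => r) z contMDiffAt_const}

/-- Subequations of order at most two on `M`: closed subsets of the 2-jet bundle with the
positivity, negativity and topological conditions. -/
structure IsSubequation (F : Set (JetBundle E M)) : Prop where
  isClosed : IsClosed F
  positivity : ∀ z, ∀ j ∈ fibre F z, ∀ k ∈ positiveJets z, j + k ∈ fibre F z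
  negativity : ∀ z, ∀ j ∈ fibre F z, ∀ k ∈ negativeJets z, j + k ∈ fibre F z
  eq_closure_interior : F = closure (interior F)
  fibre_eq_closure_interior : ∀ z, fibre F z = closure (interior (fibre F z))
  interior_fibre : ∀ z, interior (fibre F z) = fibre (interior F) z

/-- `φ` is a test function for `u` at `z` (its values away from `z` play no role). -/
structure IsTestFunction (u : M → EReal) (φ : M → ℝ) (z : M) : Prop where
  le : ∀ᶠ w in 𝓝 z, u w ≤ φ w
  eq : u z = φ z

/-- Upper semicontinuous functions with values in `[-∞, ∞)`. -/
structure IsUSC (u : M → EReal) : Prop where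
  upperSemicontinuous : UpperSemicontinuous u
  lt_top : ∀ z, u z < ⊤

/-- `u` is `F`-subharmonic on `M`. -/
structure IsSubharmonic (F : Set (JetBundle E M)) (u : M → EReal) : Prop where
  usc : IsUSC u
  jet_mem : ∀ (z : M) (φ : M → ℝ) (hφ : ContMDiffAt 𝓘(ℝ, E) 𝓘(ℝ, ℝ) 2 φ z),
    IsTestFunction u φ z → jet2 E φ z hφ ∈ fibre F z

end Jets

/-! ## Restriction to a submanifold -/

section Restriction

variable {E : Type*} [NormedAddCommGroup E] [NormedSpace ℝ E]
variable {E' : Type*} [NormedAddCommGroup E'] [NormedSpace ℝ E']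
variable {X : Type*} [TopologicalSpace X] [ChartedSpace E X]
variable {Z : Type*} [TopologicalSpace Z] [ChartedSpace E' Z]

/-- The set `i*F` of all restrictions to `X` of the 2-jets in `F` at points of `X`: the jets at `x`
of `f ∘ i`, where `f` has its 2-jet at `i x` in `F`. -/
def inducedJets (i : X → Z) (hi : ContMDiff 𝓘(ℝ, E) 𝓘(ℝ, E') ∞ i) (F : Set (JetBundle E' Z)) :
    Set (JetBundle E X) :=
  {j | ∃ (f : Z → ℝ) (hf : ContMDiffAt 𝓘(ℝ, E') 𝓘(ℝ, ℝ) 2 f (i j.base)),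
    jet2 E' f (i j.base) hf ∈ fibre F (i j.base) ∧
    j.jet = jet2 E (f ∘ i) j.base
      (hf.comp j.base ((hi j.base).of_le two_le_infty))}

variable {V W : Type*} [NormedAddCommGroup V] [NormedSpace ℝ V]
  [NormedAddCommGroup W] [InnerProductSpace ℝ W]

/-- The coordinates `z = (x, y)` on `Z` are adapted to `i : X → Z`: where they are defined, `X` is
given by the equation `y = y₀`. -/
structure IsAdapted (i : X → Z) (e : OpenPartialHomeomorph Z (V × W)) (y₀ : W) : Prop where
  isCoordinates : IsCoordinates E' e
  mem_range_iff : ∀ z ∈ e.source, z ∈ range i ↔ (e z).2 = y₀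

/-- The covector `(p, q)` on `V × W`, `q` being identified with a covector on `W` by the inner
product. -/
noncomputable def blockCovector (p : V →L[ℝ] ℝ) (q : W) : V × W →L[ℝ] ℝ :=
  p.comp (ContinuousLinearMap.fst ℝ V W) + (innerSL ℝ q).comp (ContinuousLinearMap.snd ℝ V W)

/-- The symmetric form with block matrix `diag (A, t I)` on `V × W`. -/
noncomputable def blockForm (A : Sym2Form V) (t : ℝ) : Sym2Form (V × W) :=
  ⟨A.1.bilinearComp (ContinuousLinearMap.fst ℝ V W) (ContinuousLinearMap.fst ℝ V W) +
    t • (show W →L[ℝ] W →L[ℝ] ℝ from innerSL ℝ).bilinearComp (ContinuousLinearMap.snd ℝ V W)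
      (ContinuousLinearMap.snd ℝ V W), by
    intro v w
    have h1 : A.1 v.1 w.1 = A.1 w.1 v.1 := A.2 v.1 w.1
    have h2 : inner ℝ v.2 w.2 = inner ℝ w.2 v.2 := real_inner_comm _ _
    simp only [add_apply, smul_apply,
      ContinuousLinearMap.bilinearComp_apply, ContinuousLinearMap.coe_fst',
      ContinuousLinearMap.coe_snd', h1]
    congr 2⟩

/-- The quadratic polynomial on `X`, centred at `x`, with value `r`, first derivative `p` and second
derivative `A` at `x` in the coordinates on `X` given by the `V`-part of `e ∘ i`. If `e` is adapted
to `X`, this `V`-part is indeed a local coordinate system on `X`. -/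
noncomputable def sliceQuad (i : X → Z) (e : OpenPartialHomeomorph Z (V × W)) (x : X) (r : ℝ)
    (p : V →L[ℝ] ℝ) (A : Sym2Form V) (w : X) : ℝ :=
  r + p ((e (i w)).1 - (e (i x)).1) +
    (1 / 2) * A.1 ((e (i w)).1 - (e (i x)).1) ((e (i w)).1 - (e (i x)).1)

theorem contMDiffAt_sliceQuad {i : X → Z} (hi : ContMDiff 𝓘(ℝ, E) 𝓘(ℝ, E') ∞ i)
    {e : OpenPartialHomeomorph Z (V × W)} (he : IsCoordinates E' e) {x : X}
    (hx : i x ∈ e.source) (r : ℝ) (p : V →L[ℝ] ℝ) (A : Sym2Form V) :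
    ContMDiffAt 𝓘(ℝ, E) 𝓘(ℝ, ℝ) 2 (sliceQuad i e x r p A) x := by
  have h1 : ContMDiffAt 𝓘(ℝ, E') 𝓘(ℝ, V × W) 2 e (i x) :=
    (he.1.contMDiffAt (e.open_source.mem_nhds hx)).of_le two_le_infty
  have h0 : ContMDiffAt 𝓘(ℝ, E) 𝓘(ℝ, V × W) 2 (e ∘ i) x :=
    h1.comp x ((hi x).of_le two_le_infty)
  have h2 : ContDiff ℝ 2 fun v : V × W =>
      r + p (v.1 - (e (i x)).1) + (1 / 2) * A.1 (v.1 - (e (i x)).1) (v.1 - (e (i x)).1) := by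
    fun_prop
  exact h2.contMDiff.contMDiffAt.comp x h0

/-- The restriction hypothesis for `F` and `i : X → Z`, in the coordinates `e`, adapted to `X`. -/
def RestrictionHypothesisIn (i : X → Z) (hi : ContMDiff 𝓘(ℝ, E) 𝓘(ℝ, E') ∞ i)
    (F : Set (JetBundle E' Z)) (e : OpenPartialHomeomorph Z (V × W)) (he : IsCoordinates E' e)
    (y₀ : W) : Prop :=
  ∀ (x₀ : X) (hx₀ : i x₀ ∈ e.source) (r₀ : ℝ) (p₀ : V →L[ℝ] ℝ) (A₀ : Sym2Form V)
    (ε : ℕ → ℝ) (z : ℕ → Z) (hz : ∀ k, z k ∈ e.source) (r : ℕ → ℝ),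
    (∀ k, 0 < ε k) → Tendsto ε atTop (𝓝 0) →
    (∀ k, coordJet he (hz k) (r k)
        (blockCovector (p₀ + A₀.1 ((e (z k)).1 - (e (i x₀)).1)) ((ε k)⁻¹ • ((e (z k)).2 - y₀)))
        (blockForm A₀ (ε k)⁻¹) ∈ fibre F (z k)) →
    Tendsto (fun k => (e (z k)).1) atTop (𝓝 (e (i x₀)).1) →
    Tendsto (fun k => ‖(e (z k)).2 - y₀‖ ^ 2 / ε k) atTop (𝓝 0) →
    Tendsto r atTop (𝓝 r₀) →
    jet2 E (sliceQuad i e x₀ r₀ p₀ A₀) x₀ (contMDiffAt_sliceQuad hi he hx₀ r₀ p₀ A₀) ∈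
      fibre (inducedJets i hi F) x₀

variable (V W) in
/-- The restriction hypothesis for `F` and `i : X → Z`: around each point of `X` there are
coordinates adapted to `X` in which it holds. -/
def RestrictionHypothesis (i : X → Z) (hi : ContMDiff 𝓘(ℝ, E) 𝓘(ℝ, E') ∞ i)
    (F : Set (JetBundle E' Z)) : Prop :=
  ∀ x : X, ∃ (e : OpenPartialHomeomorph Z (V × W)) (y₀ : W) (he : IsAdapted (E' := E') i e y₀),
    i x ∈ e.source ∧ RestrictionHypothesisIn i hi F e he.isCoordinates y₀

end Restriction

end ViscosityRestriction

/-! The proof is doubling by penalization. In adapted coordinates, suppose first that a quadratic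
polynomial g in the variables x satisfies u ≤ g on X near a point, with equality only there.
Maximize u - g - |y - y₀|²/(2ε) over a small compact ball in Z. At a maximum point, g + |y -
y₀|²/(2ε) plus a constant touches u from above, so its 2-jet lies in F. Re-expanded about that point
(`quad_block_eq`), it is exactly the jet in the Restriction Hypothesis. As ε → 0 the maximum points
converge to the given point and |y - y₀|²/ε → 0 (`exists_penalized_max`), so the hypothesis puts the
jet of g in i*F (`jet2_sliceQuad_mem_of_strict`).

A general test function φ on X is reduced to this case by taking its second order expansion in x and
adding (t/2)|x - x₀|² with t > 0. This beats the Taylor error and makes the contact strict, but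
changes the jet. Letting t → 0 recovers the jet of φ only in the closure of i*F
(`jet2_mem_closure`), which is why closedness enters. The expansion requires x to be a coordinate
system on X to first order (`exists_sliceDerivative`). -/

namespace ViscosityRestriction

/-! ### Penalized maxima of upper semicontinuous functions -/

section Penalization

variable {T : Type*} [TopologicalSpace T]

theorem upperSemicontinuousOn_add_coe {K : Set T} {v : T → EReal} (hv : UpperSemicontinuousOn v K)
    {g : T → ℝ} (hg : Continuous g) :
    UpperSemicontinuousOn (fun z => v z + ((g z : ℝ) : EReal)) K := by
  have h : Continuous fun z => ((g z : ℝ) : EReal) := continuous_coe_real_ereal.comp hg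
  exact hv.add' (h.upperSemicontinuous.upperSemicontinuousOn K) fun z _ =>
    EReal.continuousAt_add (Or.inr (EReal.coe_ne_bot _)) (Or.inr (EReal.coe_ne_top _))

/-- The penalization argument: if `v < g` on the zero set of `h ≥ 0` except at `z₀`, where `v = g`,
then maximum points of `v - g - h / ε` converge to `z₀` as `ε → 0`, with `h / ε → 0`. -/
theorem exists_penalized_max {K : Set T} (hK : IsCompact K) {v : T → EReal}
    (hv : UpperSemicontinuousOn v K) (hvtop : ∀ z ∈ K, v z < ⊤) {g h : T → ℝ} (hg : Continuous g)
    (hh : Continuous h) (hpos : ∀ z, 0 ≤ h z) {z₀ : T} (hz₀ : z₀ ∈ K) (hhz₀ : h z₀ = 0)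
    (hvz₀ : v z₀ = g z₀) (hlt : ∀ z ∈ K, h z = 0 → z ≠ z₀ → v z < g z) {ε : ℕ → ℝ}
    (hε : ∀ k, 0 < ε k) (hε0 : Tendsto ε atTop (𝓝 0)) :
    ∃ (z : ℕ → T) (r : ℕ → ℝ), (∀ k, z k ∈ K) ∧ (∀ k, v (z k) = r k) ∧
      (∀ k, ∀ w ∈ K, v w ≤ ((g w + h w / ε k + (r k - g (z k) - h (z k) / ε k) : ℝ) : EReal)) ∧
      Tendsto z atTop (𝓝 z₀) ∧ Tendsto (fun k => h (z k) / ε k) atTop (𝓝 0) ∧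
      Tendsto r atTop (𝓝 (g z₀)) := by
  have hmax : ∀ k, ∃ z ∈ K,
      IsMaxOn (fun z => v z + ((-(g z + h z / ε k) : ℝ) : EReal)) K z := fun k =>
    (upperSemicontinuousOn_add_coe hv (by fun_prop)).exists_isMaxOn ⟨z₀, hz₀⟩ hK
  choose z hzK hzmax using hmax
  -- The penalized function is 0 at `z₀`, so its maximum is nonnegative; this rules out the value
  -- -∞.
  have hval : ∀ k, ∃ r : ℝ, v (z k) = r ∧ g (z k) + h (z k) / ε k ≤ r := by
    intro k
    have h1 := hzmax k hz₀
    simp only [mem_ofPred_eq, hvz₀, hhz₀] at h1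
    have h2 := hvtop _ (hzK k)
    generalize v (z k) = t at h1 h2
    induction t with
    | bot =>
      rw [EReal.bot_add, ← EReal.coe_add] at h1
      exact absurd h1 (not_le.2 (EReal.bot_lt_coe _))
    | top => exact absurd h2 (lt_irrefl _)
    | coe t =>
      refine ⟨t, rfl, ?_⟩
      rw [← EReal.coe_add, ← EReal.coe_add, EReal.coe_le_coe_iff] at h1
      simp at h1
      linarith
  choose r hr hrle using hval
  have hle : ∀ k, g (z k) ≤ r k := fun k =>
    (le_add_of_nonneg_right (div_nonneg (hpos _) (hε k).le)).trans (hrle k)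
  have husc : UpperSemicontinuousOn (fun z => v z + ((-g z : ℝ) : EReal)) K :=
    upperSemicontinuousOn_add_coe hv hg.neg
  -- `v - g` attains a maximum on `K`, so `h (z k) / ε k` is bounded and `h (z k)` tends to 0.
  obtain ⟨C, hC⟩ : ∃ C : ℝ, ∀ k, r k - g (z k) ≤ C := by
    obtain ⟨a, haK, ha⟩ := husc.exists_isMaxOn ⟨z₀, hz₀⟩ hK
    have ha' : v a + ((-g a : ℝ) : EReal) ≠ ⊤ :=
      (EReal.add_lt_top (hvtop a haK).ne (EReal.coe_ne_top _)).ne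
    refine ⟨(v a + ((-g a : ℝ) : EReal)).toReal, fun k => ?_⟩
    have h1 := ha (hzK k)
    simp only [mem_ofPred_eq, hr k, ← EReal.coe_add] at h1
    have h2 := EReal.toReal_le_toReal h1 (EReal.coe_ne_bot _) ha'
    rw [EReal.toReal_coe] at h2
    linarith
  have hh0 : Tendsto (fun k => h (z k)) atTop (𝓝 0) := by
    refine squeeze_zero (g := fun k => C * ε k) (fun k => hpos _) (fun k => ?_) ?_
    · have := hrle k
      have := hC k
      rw [← div_le_iff₀ (hε k)]
      linarith
    · simpa using hε0.const_mul C
  have hz : Tendsto z atTop (𝓝 z₀) := by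
    -- A cluster point other than `z₀` would lie in the zero set of `h`, where `v - g < 0`. By
    -- semicontinuity this persists nearby, contradicting `g (z k) ≤ r k`.
    refine hK.tendsto_nhds_of_unique_mapClusterPt (Eventually.of_forall hzK) fun a haK ha => ?_
    by_contra hne
    have hha : h a = 0 := by
      have h1 : MapClusterPt (h a) atTop (h ∘ z) := ha.continuousAt_comp hh.continuousAt
      have h2 : ClusterPt (h a) (𝓝 0) := ClusterPt.mono h1 hh0
      exact (eq_of_nhds_neBot h2)
    have h1 : v a + ((-g a : ℝ) : EReal) < 0 := by
      have h0 := hlt a haK hha hne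
      generalize v a = t at h0
      induction t with
      | bot => simp
      | top => simp at h0
      | coe t =>
        rw [EReal.coe_lt_coe_iff] at h0
        rw [← EReal.coe_add]
        exact_mod_cast (by linarith : t + -g a < 0)
    have h2 := husc a haK 0 h1
    rw [eventually_nhdsWithin_iff] at h2
    obtain ⟨k, hk⟩ := (ha.frequently h2).exists
    have h3 : v (z k) + ((-g (z k) : ℝ) : EReal) < 0 := hk (hzK k)
    rw [hr k, ← EReal.coe_add] at h3
    have h4 : r k + -g (z k) < 0 := by exact_mod_cast h3
    linarith [hle k]
  -- Semicontinuity at `z₀` bounds this difference above. It dominates `h (z k) / ε k ≥ 0`, which is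
  -- then squeezed to 0.
  have hdiff : Tendsto (fun k => r k - g (z k)) atTop (𝓝 0) := by
    rw [Metric.tendsto_atTop']
    intro η hη
    have h1 : v z₀ + ((-g z₀ : ℝ) : EReal) < (η : EReal) := by
      rw [hvz₀, ← EReal.coe_add]
      exact_mod_cast (by linarith : g z₀ + -g z₀ < η)
    have h2 := husc z₀ hz₀ η h1
    rw [eventually_nhdsWithin_iff] at h2
    obtain ⟨N, hN⟩ := eventually_atTop.1 (hz.eventually h2)
    refine ⟨N, fun k hk => ?_⟩
    have h3 : v (z k) + ((-g (z k) : ℝ) : EReal) < η := hN k hk.le (hzK k)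
    rw [hr k, ← EReal.coe_add, EReal.coe_lt_coe_iff] at h3
    rw [Real.dist_eq, sub_zero, abs_of_nonneg (sub_nonneg.2 (hle k))]
    linarith
  refine ⟨z, r, hzK, hr, fun k w hw => ?_, hz, ?_, ?_⟩
  · have h1 := hzmax k hw
    simp only [mem_ofPred_eq, hr k] at h1
    generalize v w = t at h1
    induction t with
    | bot => exact bot_le
    | top =>
      rw [← EReal.coe_add, EReal.top_add_coe] at h1
      exact absurd h1 (not_le.2 (EReal.coe_lt_top _))
    | coe t =>
      rw [← EReal.coe_add, ← EReal.coe_add, EReal.coe_le_coe_iff] at h1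
      rw [EReal.coe_le_coe_iff]
      linarith
  · exact squeeze_zero (fun k => div_nonneg (hpos _) (hε k).le)
      (fun k => by linarith [hrle k]) hdiff
  · simpa using hdiff.add ((hg.tendsto z₀).comp hz)

end Penalization

/-! ### Second order expansions -/

section Taylor

open Asymptotics

variable {E V : Type*} [NormedAddCommGroup E] [NormedSpace ℝ E]
  [NormedAddCommGroup V] [NormedSpace ℝ V]

/-- Taylor's formula of order two. -/
theorem taylor_two_isLittleO {f : E → ℝ} {a : E} (hf : ContDiffAt ℝ 2 f a) :
    (fun x => f x - (f a + fderiv ℝ f a (x - a) +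
      (1 / 2) * fderiv ℝ (fderiv ℝ f) a (x - a) (x - a))) =o[𝓝 a] fun x => ‖x - a‖ ^ 2 := by
  have hsymm : IsSymmSndFDerivAt ℝ f a := hf.isSymmSndFDerivAt (by simp)
  have hf1 : ContDiffAt ℝ 1 (fderiv ℝ f) a := hf.fderiv_right (by norm_num)
  have hd : HasFDerivAt (fderiv ℝ f) (fderiv ℝ (fderiv ℝ f) a) a :=
    (hf1.differentiableAt (by norm_num)).hasFDerivAt
  have hev : ∀ᶠ x in 𝓝 a, DifferentiableAt ℝ f x :=
    (hf.eventually (by simp)).mono fun x hx => hx.differentiableAt (by norm_num)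
  obtain ⟨ρ, hρ, hball⟩ := Metric.eventually_nhds_iff_ball.1 hev
  set B := fderiv ℝ (fderiv ℝ f) a with hB
  -- The derivative of the remainder is the first order remainder of `fderiv ℝ f`, by symmetry of
  -- `B`; integrating on a ball gains one order.
  have key := (convex_ball a ρ).isLittleO_pow_succ (n := 1) (Metric.mem_ball_self hρ)
    (f := fun x => f x - (f a + fderiv ℝ f a (x - a) + (1 / 2) * B (x - a) (x - a)))
    (f' := fun x => fderiv ℝ f x - fderiv ℝ f a - B (x - a)) (fun x hx => ?_) ?_
  · rw [Metric.isOpen_ball.nhdsWithin_eq (Metric.mem_ball_self hρ)] at key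
    simpa using key
  · have h1 : HasFDerivAt (fun x : E => x - a) (ContinuousLinearMap.id ℝ E) x :=
      (hasFDerivAt_id x).sub_const a
    have h2 : HasFDerivAt (fun x => B (x - a) (x - a)) _ x :=
      (B.hasFDerivAt.comp x h1).clm_apply h1
    have h3 := (hball x hx).hasFDerivAt.sub
      ((((fderiv ℝ f a).hasFDerivAt.comp x h1).const_add (f a)).add (h2.const_mul (1 / 2)))
    refine (h3.congr_fderiv ?_).hasFDerivWithinAt
    ext v
    have := hsymm v (x - a)
    simp only [← hB, map_sub, sub_apply] at this
    simp
    linarith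
  · rw [Metric.isOpen_ball.nhdsWithin_eq (Metric.mem_ball_self hρ)]
    simpa using hd.isLittleO.norm_right

/-- The second derivative, as a symmetric form. -/
noncomputable def sndDeriv {f : E → ℝ} {a : E} (hf : ContDiffAt ℝ 2 f a) : Sym2Form E :=
  ⟨fderiv ℝ (fderiv ℝ f) a, fun v w => hf.isSymmSndFDerivAt (by simp) v w⟩

/-- Second order expansion of `f` in terms of coordinates `g`. -/
theorem exists_expansion {f : E → ℝ} {g : E → V} {a : E} (hf : ContDiffAt ℝ 2 f a)
    (hg : ContDiffAt ℝ 2 g a) {L : E ≃L[ℝ] V} (hL : HasFDerivAt g (L : E →L[ℝ] V) a) :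
    ∃ (p : V →L[ℝ] ℝ) (A : Sym2Form V),
      (fun x => f x - (f a + p (g x - g a) + (1 / 2) * A.1 (g x - g a) (g x - g a))) =o[𝓝 a]
        fun x => ‖x - a‖ ^ 2 := by
  -- This `p` makes `f - p ∘ g` critical at `a`. Its expansion is then purely quadratic, so `x - a`
  -- may be replaced by `L⁻¹ (g x - g a)` using only the first order behaviour of `g`.
  set p : V →L[ℝ] ℝ := (fderiv ℝ f a).comp (L.symm : V →L[ℝ] E) with hp
  have hh : ContDiffAt ℝ 2 (fun x => f x - p (g x)) a :=
    hf.sub (p.contDiff.contDiffAt.comp a hg)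
  have hder : fderiv ℝ (fun x => f x - p (g x)) a = 0 := by
    have h1 := (hf.differentiableAt (by norm_num)).hasFDerivAt.sub (p.hasFDerivAt.comp a hL)
    refine h1.fderiv.trans ?_
    ext v
    simp [hp]
  set B := sndDeriv hh with hB
  let A : Sym2Form V := ⟨B.1.bilinearComp (L.symm : V →L[ℝ] E) (L.symm : V →L[ℝ] E), fun v w => by
    simpa using B.2 (L.symm v) (L.symm w)⟩
  refine ⟨p, A, ?_⟩
  have hT := taylor_two_isLittleO hh
  rw [hder] at hT
  have hR : (fun x => g x - g a - L (x - a)) =o[𝓝 a] fun x => x - a := hL.isLittleO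
  have hG : (fun x => g x - g a) =O[𝓝 a] fun x => x - a := hL.isBigO_sub
  have hLO : (fun x => L (x - a)) =O[𝓝 a] fun x => x - a :=
    (L : E →L[ℝ] V).isBigO_sub _ _ |>.congr_left (by simp)
  have hq : ∀ (b c : E → V), b =o[𝓝 a] (fun x => x - a) → c =O[𝓝 a] (fun x => x - a) →
      (fun x => A.1 (b x) (c x)) =o[𝓝 a] fun x => ‖x - a‖ ^ 2 := by
    intro b c hb hc
    have h1 : (fun x => A.1 (b x) (c x)) =O[𝓝 a] fun x => ‖b x‖ * ‖c x‖ :=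
      IsBigO.of_bound ‖A.1‖ (Eventually.of_forall fun x => by
        simpa [mul_assoc] using A.1.le_opNorm₂ (b x) (c x))
    refine h1.trans_isLittleO ?_
    simpa [sq] using hb.norm_norm.mul_isBigO hc.norm_norm
  -- With G = g x - g a, l = L (x - a) and R = G - l, symmetry gives A(G, G) - A(l, l) = A(R, G) +
  -- A(R, l).
  have h3 := (hq _ _ hR hG).add (hq _ _ hR hLO)
  refine (hT.sub (h3.const_mul_left (1 / 2))).congr_left fun x => ?_
  have hA : A.1 (L (x - a)) (L (x - a)) = B.1 (x - a) (x - a) := by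
    simp [A]
  have hBB : fderiv ℝ (fderiv ℝ fun x => f x - p (g x)) a (x - a) (x - a) =
      A.1 (L (x - a)) (L (x - a)) := hA.symm
  have hs := A.2 (g x - g a) (L (x - a))
  rw [hBB]
  generalize L (x - a) = l at *
  simp only [map_sub, sub_apply, zero_apply] at *
  linarith

/-- Since `L` is invertible, |x - a| = O(|g x - g a|) near `a`. This is what lets a small quadratic
term absorb the Taylor error and make contact strict. -/
theorem eventually_lt_of_isLittleO {c : E → ℝ} {g : E → V} {a : E}
    (hc : c =o[𝓝 a] fun x => ‖x - a‖ ^ 2) {L : E ≃L[ℝ] V} (hL : HasFDerivAt g (L : E →L[ℝ] V) a)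
    {δ : ℝ} (hδ : 0 < δ) : ∀ᶠ x in 𝓝 a, x ≠ a → c x < δ * ‖g x - g a‖ ^ 2 := by
  have hO : (fun x => x - a) =O[𝓝 a] fun x => g x - g a :=
    (hL.isTheta_sub L.toHomeomorph.isInducing).2
  have h := hc.trans_isBigO (hO.norm_norm.pow 2)
  have hne : ∀ᶠ x in 𝓝 a, x ≠ a → g x ≠ g a := by
    filter_upwards [hO.eq_zero_imp] with x hx hxa hg
    exact hxa (sub_eq_zero.1 (hx (sub_eq_zero.2 hg)))
  filter_upwards [h.def (half_pos hδ), hne] with x hx hn hxa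
  have h1 : 0 < ‖g x - g a‖ ^ 2 := by
    have := norm_pos_iff.2 (sub_ne_zero.2 (hn hxa))
    positivity
  rw [norm_pow, norm_norm] at hx
  have := (le_abs_self (c x)).trans hx
  nlinarith

end Taylor

/-! ### 2-jets in charts and limits of jets -/

theorem eventually_chartAt_of_eventually {E M : Type*} [TopologicalSpace E]
    [TopologicalSpace M] [ChartedSpace E M] {P : E → M → Prop} {z : M}
    (h : ∀ᶠ x in 𝓝 (chartAt E z z), P x ((chartAt E z).symm x)) :
    ∀ᶠ w in 𝓝 z, P (chartAt E z w) w := by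
  filter_upwards [((chartAt E z).continuousAt (mem_chart_source E z)).eventually h,
    (chartAt E z).open_source.mem_nhds (mem_chart_source E z)] with w hw hws
  rwa [(chartAt E z).left_inv hws] at hw

section JetLemmas

open Asymptotics

variable {E : Type*} [NormedAddCommGroup E] [NormedSpace ℝ E]
variable {M : Type*} [TopologicalSpace M] [ChartedSpace E M]
variable {V : Type*} [NormedAddCommGroup V] [NormedSpace ℝ V]

theorem isCoordinates_of_mem_maximalAtlas {e : OpenPartialHomeomorph M E}
    (he : e ∈ IsManifold.maximalAtlas 𝓘(ℝ, E) ∞ M) : IsCoordinates E e :=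
  ⟨contMDiffOn_of_mem_maximalAtlas he, contMDiffOn_symm_of_mem_maximalAtlas he⟩

theorem isCoordinates_chartAt [IsManifold 𝓘(ℝ, E) ∞ M] (z : M) : IsCoordinates E (chartAt E z) :=
  isCoordinates_of_mem_maximalAtlas (IsManifold.chart_mem_maximalAtlas z)

theorem IsCoordinates.contMDiffAt {e : OpenPartialHomeomorph M V} (he : IsCoordinates E e) {z : M}
    (hz : z ∈ e.source) : ContMDiffAt 𝓘(ℝ, E) 𝓘(ℝ, V) ∞ e z :=
  he.1.contMDiffAt (e.open_source.mem_nhds hz)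

theorem IsCoordinates.contMDiffAt_symm {e : OpenPartialHomeomorph M V} (he : IsCoordinates E e)
    {v : V} (hv : v ∈ e.target) : ContMDiffAt 𝓘(ℝ, V) 𝓘(ℝ, E) ∞ e.symm v :=
  he.2.contMDiffAt (e.open_target.mem_nhds hv)

theorem contDiffAt_comp_chartAt_symm [IsManifold 𝓘(ℝ, E) ∞ M] {f : M → V} {z : M}
    (hf : ContMDiffAt 𝓘(ℝ, E) 𝓘(ℝ, V) 2 f z) :
    ContDiffAt ℝ 2 (f ∘ (chartAt E z).symm) (chartAt E z z) := by
  have h : ContMDiffAt 𝓘(ℝ, E) 𝓘(ℝ, E) 2 (chartAt E z).symm (chartAt E z z) :=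
    ((isCoordinates_chartAt (E := E) z).contMDiffAt_symm (mem_chart_target E z)).of_le two_le_infty
  exact (hf.comp_of_eq h ((chartAt E z).left_inv (mem_chart_source E z))).contDiffAt

theorem isLittleO_of_comp_chartAt_symm {E M : Type*} [NormedAddCommGroup E]
    [TopologicalSpace M] [ChartedSpace E M] {f : M → ℝ} {z : M}
    (h : (f ∘ (chartAt E z).symm) =o[𝓝 (chartAt E z z)] fun x => ‖x - chartAt E z z‖ ^ 2) :
    f =o[𝓝 z] fun w => ‖chartAt E z w - chartAt E z z‖ ^ 2 := by
  refine isLittleO_iff.2 fun c hc => ?_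
  exact eventually_chartAt_of_eventually (P := fun x w => ‖f w‖ ≤ c * ‖‖x - chartAt E z z‖ ^ 2‖)
    (isLittleO_iff.1 h hc)

theorem jet2_eq_iff {f g : M → ℝ} {z : M} (hf : ContMDiffAt 𝓘(ℝ, E) 𝓘(ℝ, ℝ) 2 f z)
    (hg : ContMDiffAt 𝓘(ℝ, E) 𝓘(ℝ, ℝ) 2 g z) :
    jet2 E f z hf = jet2 E g z hg ↔
      (fun w => f w - g w) =o[𝓝 z] fun w => ‖chartAt E z w - chartAt E z z‖ ^ 2 :=
  Submodule.Quotient.eq _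

/-- A `C²` function agrees to second order with a quadratic polynomial in the preferred chart. -/
theorem exists_quad_isLittleO [IsManifold 𝓘(ℝ, E) ∞ M] {f : M → ℝ} {z : M}
    (hf : ContMDiffAt 𝓘(ℝ, E) 𝓘(ℝ, ℝ) 2 f z) :
    ∃ (p : E →L[ℝ] ℝ) (A : Sym2Form E),
      (fun w => f w - quad (chartAt E z) z (f z) p A w) =o[𝓝 z]
        fun w => ‖chartAt E z w - chartAt E z z‖ ^ 2 := by
  have hf' := contDiffAt_comp_chartAt_symm hf
  refine ⟨fderiv ℝ (f ∘ (chartAt E z).symm) (chartAt E z z), sndDeriv hf',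
    isLittleO_of_comp_chartAt_symm ?_⟩
  refine (taylor_two_isLittleO hf').congr' ?_ EventuallyEq.rfl
  filter_upwards [(chartAt E z).open_target.mem_nhds (mem_chart_target E z)] with x hx
  simp only [Function.comp_apply, quad, (chartAt E z).right_inv hx,
    (chartAt E z).left_inv (mem_chart_source E z)]
  rfl

theorem continuous_coordJet {e : OpenPartialHomeomorph M E} (he : IsCoordinates E e) :
    Continuous fun q : e.source × ℝ × (E →L[ℝ] ℝ) × Sym2Form E =>
      (⟨q.1, coordJet he q.1.2 q.2.1 q.2.2.1 q.2.2.2⟩ : JetBundle E M) := by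
  rw [continuous_iff_coinduced_le]
  exact le_iSup₂ (f := fun (e : OpenPartialHomeomorph M E) (he : IsCoordinates E e) =>
    TopologicalSpace.coinduced
      (fun q : e.source × ℝ × (E →L[ℝ] ℝ) × Sym2Form E =>
        (⟨q.1, coordJet he q.1.2 q.2.1 q.2.2.1 q.2.2.2⟩ : JetBundle E M))
      inferInstance) e he

theorem contMDiffAt_add_const_mul {f ψ : M → ℝ} {z : M} (hf : ContMDiffAt 𝓘(ℝ, E) 𝓘(ℝ, ℝ) 2 f z)
    (hψ : ContMDiffAt 𝓘(ℝ, E) 𝓘(ℝ, ℝ) 2 ψ z) (t : ℝ) :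
    ContMDiffAt 𝓘(ℝ, E) 𝓘(ℝ, ℝ) 2 (fun w => f w + t * ψ w) z :=
  (C2At E z).add_mem hf ((C2At E z).smul_mem t hψ)

-- In chart components the jet of `f + t ψ` is affine in `t`, hence a continuous path in the jet
-- bundle; let t → 0 from the right.
set_option maxSynthPendingDepth 3 in
theorem jet2_mem_closure [IsManifold 𝓘(ℝ, E) ∞ M] {S : Set (JetBundle E M)} {f ψ : M → ℝ} {z : M}
    (hf : ContMDiffAt 𝓘(ℝ, E) 𝓘(ℝ, ℝ) 2 f z) (hψ : ContMDiffAt 𝓘(ℝ, E) 𝓘(ℝ, ℝ) 2 ψ z)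
    (h : ∀ t : ℝ, 0 < t → jet2 E (fun w => f w + t * ψ w) z (contMDiffAt_add_const_mul hf hψ t) ∈
      fibre S z) : jet2 E f z hf ∈ fibre (closure S) z := by
  obtain ⟨p, A, hfj⟩ := exists_quad_isLittleO hf
  obtain ⟨p', A', hψj⟩ := exists_quad_isLittleO hψ
  have he := isCoordinates_chartAt (E := E) z
  have hjet : ∀ t : ℝ, jet2 E (fun w => f w + t * ψ w) z (contMDiffAt_add_const_mul hf hψ t) =
      coordJet he (mem_chart_source E z) (f z + t * ψ z) (p + t • p') (A + t • A') := by
    intro t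
    rw [coordJet, jet2_eq_iff]
    refine (hfj.add (hψj.const_mul_left t)).congr_left fun w => ?_
    simp only [quad, Submodule.coe_add, Submodule.coe_smul, add_apply,
      smul_apply, smul_eq_mul]
    ring
  have hcont : Continuous fun t : ℝ => (⟨z, coordJet he (mem_chart_source E z)
      (f z + t * ψ z) (p + t • p') (A + t • A')⟩ : JetBundle E M) :=
    (continuous_coordJet he).comp (by fun_prop :
      Continuous fun t : ℝ => ((⟨z, mem_chart_source E z⟩, f z + t * ψ z, p + t • p', A + t • A') :
        (chartAt E z).source × ℝ × (E →L[ℝ] ℝ) × Sym2Form E))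
  have h0 : jet2 E f z hf = coordJet he (mem_chart_source E z) (f z + (0 : ℝ) * ψ z)
      (p + (0 : ℝ) • p') (A + (0 : ℝ) • A') := by
    rw [← hjet 0, jet2_eq_iff]
    simp
  have hlim := (hcont.tendsto 0).mono_left (nhdsWithin_le_nhds (s := Ioi 0))
  rw [← h0] at hlim
  refine mem_closure_of_tendsto hlim (eventually_nhdsWithin_of_forall fun t ht => ?_)
  have := h t ht
  rw [hjet t] at this
  exact this

end JetLemmas

/-! ### Adapted coordinates along the submanifold -/

section Slice

variable {E : Type*} [NormedAddCommGroup E] [NormedSpace ℝ E]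
variable {E' : Type*} [NormedAddCommGroup E'] [NormedSpace ℝ E']
variable {X : Type*} [TopologicalSpace X] [ChartedSpace E X] [IsManifold 𝓘(ℝ, E) ∞ X]
variable {Z : Type*} [TopologicalSpace Z] [ChartedSpace E' Z]
variable {V W : Type*} [NormedAddCommGroup V] [NormedSpace ℝ V]
  [NormedAddCommGroup W] [InnerProductSpace ℝ W]

/-- An immersion has a smooth local left inverse, with values in the preferred chart. -/
theorem exists_leftInverse_of_isImmersionAt {i : X → Z} {x : X}
    (hi : IsImmersionAt 𝓘(ℝ, E) 𝓘(ℝ, E') ∞ i x) :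
    ∃ ρ : Z → E, ContMDiffAt 𝓘(ℝ, E') 𝓘(ℝ, E) ∞ ρ (i x) ∧
      ∀ᶠ w in 𝓝 x, ρ (i w) = chartAt E x w := by
  have hc := isCoordinates_of_mem_maximalAtlas hi.codChart_mem_maximalAtlas
  have hd := isCoordinates_of_mem_maximalAtlas hi.domChart_mem_maximalAtlas
  set d := hi.domChart
  set c := hi.codChart
  have hdx : x ∈ d.source := hi.mem_domChart_source
  -- In the normal form of an immersion, `i` reads v ↦ (v, 0), so the first projection inverts it.
  have hval : ∀ w ∈ d.source, (hi.equiv.symm (c (i w))).1 = d w := by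
    intro w hw
    have h1 := hi.writtenInCharts (by simpa using d.map_source hw : d w ∈ (d.extend 𝓘(ℝ, E)).target)
    have h2 : c (i w) = hi.equiv (d w, 0) := by
      simpa [c, d, hi.domChart.left_inv hw] using h1
    rw [h2]
    simp
  refine ⟨fun z => chartAt E x (d.symm (hi.equiv.symm (c z)).1), ?_, ?_⟩
  · have h1 : ContMDiffAt 𝓘(ℝ, E') 𝓘(ℝ, E') ∞ c (i x) := hc.contMDiffAt hi.mem_codChart_source
    have h2 : ContDiff ℝ ∞ fun v : E' => (hi.equiv.symm v).1 := by fun_prop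
    have h3 : ContMDiffAt 𝓘(ℝ, E') 𝓘(ℝ, E) ∞ (fun z => (hi.equiv.symm (c z)).1) (i x) :=
      h2.contMDiff.contMDiffAt.comp (i x) h1
    have h4 : ContMDiffAt 𝓘(ℝ, E') 𝓘(ℝ, E) ∞ (fun z => d.symm (hi.equiv.symm (c z)).1) (i x) :=
      (hd.contMDiffAt_symm (d.map_source hdx)).comp_of_eq h3 (hval x hdx)
    exact ((isCoordinates_chartAt (E := E) x).contMDiffAt (mem_chart_source E x)).comp_of_eq h4
      (by rw [hval x hdx, d.left_inv hdx])
  · filter_upwards [d.open_source.mem_nhds hdx] with w hw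
    rw [hval w hw, d.left_inv hw]

/-- The `V`-part of adapted coordinates is a coordinate system, to first order, on the
submanifold. -/
theorem exists_sliceDerivative [FiniteDimensional ℝ E] [FiniteDimensional ℝ V]
    (hdim : Module.finrank ℝ E = Module.finrank ℝ V) {i : X → Z} {x : X}
    (hi : IsImmersionAt 𝓘(ℝ, E) 𝓘(ℝ, E') ∞ i x) {e : OpenPartialHomeomorph Z (V × W)} {y₀ : W}
    (he : IsAdapted (E' := E') i e y₀) (hx : i x ∈ e.source) :
    ∃ L : E ≃L[ℝ] V, HasFDerivAt ((fun w => (e (i w)).1) ∘ (chartAt E x).symm)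
      (L : E →L[ℝ] V) (chartAt E x x) := by
  obtain ⟨ρ, hρ, hρi⟩ := exists_leftInverse_of_isImmersionAt hi
  set a := chartAt E x x with ha
  set G : E → V × W := (fun w => e (i w)) ∘ (chartAt E x).symm with hG
  have hsx : (chartAt E x).symm a = x := (chartAt E x).left_inv (mem_chart_source E x)
  have hsymm : ContinuousAt (chartAt E x).symm a :=
    (chartAt E x).continuousAt_symm (mem_chart_target E x)
  have hGd : DifferentiableAt ℝ G a := by
    have h1 : ContMDiffAt 𝓘(ℝ, E) 𝓘(ℝ, V × W) ∞ (fun w => e (i w)) x :=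
      (he.isCoordinates.contMDiffAt hx).comp x hi.contMDiffAt
    exact (contDiffAt_comp_chartAt_symm (h1.of_le two_le_infty)).differentiableAt (by norm_num)
  have hGa : G a = e (i x) := by simp [hG, hsx]
  have hR : DifferentiableAt ℝ (ρ ∘ e.symm) (G a) := by
    have h1 : ContMDiffAt 𝓘(ℝ, V × W) 𝓘(ℝ, E) ∞ (ρ ∘ e.symm) (G a) := by
      refine hρ.comp_of_eq (he.isCoordinates.contMDiffAt_symm ?_) ?_
      · rw [hGa]; exact e.map_source hx
      · rw [hGa, e.left_inv hx]
    exact h1.contDiffAt.differentiableAt (by simp)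
  have hsrc : ∀ᶠ w in 𝓝 x, i w ∈ e.source :=
    hi.continuousAt.eventually (e.open_source.mem_nhds hx)
  have hsymm' : Tendsto (chartAt E x).symm (𝓝 a) (𝓝 x) := by
    simpa [ContinuousAt, hsx] using hsymm
  have hRG : (ρ ∘ e.symm) ∘ G =ᶠ[𝓝 a] id := by
    filter_upwards [hsymm'.eventually hsrc, hsymm'.eventually hρi,
      (chartAt E x).open_target.mem_nhds (mem_chart_target E x)] with v hv hv' hvt
    simp only [hG, Function.comp_apply, e.left_inv hv, hv', id, (chartAt E x).right_inv hvt]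
  have hcomp : ∀ v, fderiv ℝ (ρ ∘ e.symm) (G a) (fderiv ℝ G a v) = v := by
    intro v
    have h1 := (hR.hasFDerivAt.comp a hGd.hasFDerivAt).congr_of_eventuallyEq hRG.symm
    have h2 := h1.unique (hasFDerivAt_id a)
    simpa using congrArg (fun T : E →L[ℝ] E => T v) h2
  -- The y-part is constant along X, so injectivity of `fderiv ℝ G a` passes to its V-part, which is
  -- then bijective by equality of dimensions.
  have hsnd : ∀ v, (fderiv ℝ G a v).2 = 0 := by
    intro v
    have h1 : (fun v => (G v).2) =ᶠ[𝓝 a] fun _ => y₀ := by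
      filter_upwards [hsymm'.eventually hsrc] with v hv
      exact (he.mem_range_iff _ hv).1 (mem_range_self _)
    have h2 := hGd.hasFDerivAt.snd.unique ((hasFDerivAt_const y₀ a).congr_of_eventuallyEq h1)
    simpa using congrArg (fun T : E →L[ℝ] W => T v) h2
  have hfst := hGd.hasFDerivAt.fst
  set L₀ : E →L[ℝ] V := (ContinuousLinearMap.fst ℝ V W).comp (fderiv ℝ G a) with hL₀
  have hinj : Function.Injective L₀ := by
    refine (injective_iff_map_eq_zero L₀).2 fun v hv => ?_
    rw [← hcomp v, show fderiv ℝ G a v = 0 from Prod.ext hv (hsnd v), map_zero]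
  let L := ((L₀ : E →ₗ[ℝ] V).linearEquivOfInjective hinj hdim).toContinuousLinearEquiv
  have hLL : (L : E →L[ℝ] V) = L₀ := by
    ext v
    rfl
  exact ⟨L, hLL ▸ hfst⟩

end Slice

/-! ### Restriction of subharmonic functions -/

section Main

variable {E : Type*} [NormedAddCommGroup E] [NormedSpace ℝ E]
variable {E' : Type*} [NormedAddCommGroup E'] [NormedSpace ℝ E']
variable {X : Type*} [TopologicalSpace X] [ChartedSpace E X]
variable {Z : Type*} [TopologicalSpace Z] [ChartedSpace E' Z]

/-- Expansion at `z` of a quadratic polynomial in block form. -/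
theorem quad_block_eq {V W : Type*} [NormedAddCommGroup V] [NormedSpace ℝ V]
    [NormedAddCommGroup W] [InnerProductSpace ℝ W] (e : OpenPartialHomeomorph Z (V × W)) (z w : Z)
    (r r₀ : ℝ) (p : V →L[ℝ] ℝ) (A : Sym2Form V) (x₀ : V) (y₀ : W) (ε : ℝ) :
    quad e z r (blockCovector (p + A.1 ((e z).1 - x₀)) (ε⁻¹ • ((e z).2 - y₀)))
      (blockForm A ε⁻¹) w =
    (r₀ + p ((e w).1 - x₀) + (1 / 2) * A.1 ((e w).1 - x₀) ((e w).1 - x₀)) +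
      ((1 / 2) * ‖(e w).2 - y₀‖ ^ 2) / ε +
      (r - (r₀ + p ((e z).1 - x₀) + (1 / 2) * A.1 ((e z).1 - x₀) ((e z).1 - x₀)) -
        ((1 / 2) * ‖(e z).2 - y₀‖ ^ 2) / ε) := by
  obtain ⟨a, ha⟩ : ∃ a, a = (e z).1 - x₀ := ⟨_, rfl⟩
  obtain ⟨b, hb⟩ : ∃ b, b = (e w).1 - x₀ := ⟨_, rfl⟩
  obtain ⟨c, hc⟩ : ∃ c, c = (e z).2 - y₀ := ⟨_, rfl⟩
  obtain ⟨d, hd⟩ : ∃ d, d = (e w).2 - y₀ := ⟨_, rfl⟩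
  have h1 : (e w - e z).1 = b - a := by rw [ha, hb, Prod.fst_sub]; abel
  have h2 : (e w - e z).2 = d - c := by rw [hc, hd, Prod.snd_sub]; abel
  have hq : blockCovector (p + A.1 a) (ε⁻¹ • c) (e w - e z) =
      p (b - a) + A.1 a (b - a) + ε⁻¹ * inner ℝ c (d - c) := by
    simp [blockCovector, ← h1, ← h2]
  have hQ : (blockForm A ε⁻¹ : Sym2Form (V × W)).1 (e w - e z) (e w - e z) =
      A.1 (b - a) (b - a) + ε⁻¹ * inner ℝ (d - c) (d - c) := by
    rw [← h1, ← h2]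
    rfl
  rw [quad, ← ha, ← hb, ← hc, ← hd, hq, hQ, ← real_inner_self_eq_norm_sq,
    ← real_inner_self_eq_norm_sq]
  have hs := A.2 a b
  have hs' := real_inner_comm c d
  simp only [map_sub, sub_apply, inner_sub_left, inner_sub_right, div_eq_mul_inv, hs, hs']
  ring

variable {V W : Type*} [NormedAddCommGroup V] [NormedSpace ℝ V] [ProperSpace V]
  [NormedAddCommGroup W] [InnerProductSpace ℝ W] [ProperSpace W]

/-- The jets of strict quadratic test functions on the submanifold lie in the induced set. -/
theorem jet2_sliceQuad_mem_of_strict {i : X → Z} (hi : ContMDiff 𝓘(ℝ, E) 𝓘(ℝ, E') ∞ i)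
    (hemb : IsEmbedding i) {F : Set (JetBundle E' Z)} {e : OpenPartialHomeomorph Z (V × W)} {y₀ : W}
    (he : IsAdapted (E' := E') i e y₀)
    (hres : RestrictionHypothesisIn i hi F e he.isCoordinates y₀) {u : Z → EReal}
    (hu : IsSubharmonic F u) {x : X} (hx : i x ∈ e.source) {r : ℝ} {p : V →L[ℝ] ℝ} {A : Sym2Form V}
    (hux : u (i x) = r) (hlt : ∀ᶠ w in 𝓝 x, w ≠ x → u (i w) < sliceQuad i e x r p A w) :
    jet2 E (sliceQuad i e x r p A) x (contMDiffAt_sliceQuad hi he.isCoordinates hx r p A) ∈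
      fibre (inducedJets i hi F) x := by
  obtain ⟨N, hN, hNlt⟩ := eventually_iff_exists_mem.1 hlt
  -- Being an embedding ensures that every point of X whose image is close to `i x` in Z is itself
  -- close to `x`, so the strict inequality holds on the whole slice y = y₀ of a small ball.
  rw [hemb.nhds_eq_comap, mem_comap] at hN
  obtain ⟨O, hO, hON⟩ := hN
  have htarget : e (i x) ∈ e.target := e.map_source hx
  have hcont : ContinuousAt e.symm (e (i x)) := e.continuousAt_symm htarget
  have hnhds : e.target ∩ e.symm ⁻¹' O ∈ 𝓝 (e (i x)) := by
    refine inter_mem (e.open_target.mem_nhds htarget) (hcont ?_)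
    rwa [e.left_inv hx]
  obtain ⟨ρ, hρ, hball⟩ := Metric.nhds_basis_closedBall.mem_iff.1 hnhds
  have hy₀ : (e (i x)).2 = y₀ := (he.mem_range_iff _ hx).1 (mem_range_self x)
  set x₀ : V := (e (i x)).1 with hx₀
  have hε : ∀ k : ℕ, 0 < 1 / ((k : ℝ) + 1) := fun k => by positivity
  obtain ⟨ζ, s, hζK, hs, hmax, hζ, hpen, hslim⟩ := exists_penalized_max
    (K := Metric.closedBall (e (i x)) ρ) (isCompact_closedBall _ _) (v := u ∘ e.symm)
    (g := fun z => r + p (z.1 - x₀) + (1 / 2) * A.1 (z.1 - x₀) (z.1 - x₀))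
    (h := fun z => (1 / 2) * ‖z.2 - y₀‖ ^ 2) (z₀ := e (i x))
    (by
      have h1 : ContinuousOn e.symm (Metric.closedBall (e (i x)) ρ) :=
        e.continuousOn_symm.mono fun z hz => (hball hz).1
      exact (hu.usc.upperSemicontinuous.upperSemicontinuousOn univ).comp h1 (mapsTo_univ _ _))
    (fun z _ => hu.usc.lt_top _) (by fun_prop) (by fun_prop) (fun z => by positivity)
    (Metric.mem_closedBall_self hρ.le) (by simp [hy₀]) (by simp [e.left_inv hx, hux, hx₀])
    (by
      intro z hz hz0 hne
      have hzy : z.2 = y₀ := by simpa [sub_eq_zero] using hz0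
      have hzt := (hball hz).1
      obtain ⟨w, hw⟩ : e.symm z ∈ range i := by
        rw [he.mem_range_iff _ (e.map_target hzt), e.right_inv hzt, hzy]
      have hwN : w ∈ N := hON (by rw [mem_preimage, hw]; exact (hball hz).2)
      have hwx : w ≠ x := by
        rintro rfl
        exact hne (by rw [hw, e.right_inv hzt])
      have := hNlt w hwN hwx
      rwa [sliceQuad, hw, e.right_inv hzt] at this)
    hε tendsto_one_div_add_atTop_nhds_zero_nat
  -- From `n₀` on, the maximum points are interior to the ball, so maximality over the ball yields
  -- genuine local test functions.
  obtain ⟨n₀, hn₀⟩ := eventually_atTop.1 (hζ.eventually (Metric.ball_mem_nhds (e (i x)) hρ))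
  have hshift : Tendsto (fun k => k + n₀) atTop atTop := tendsto_add_atTop_nat n₀
  have hzt : ∀ k, ζ k ∈ e.target := fun k => (hball (hζK k)).1
  have hez : ∀ k, e (e.symm (ζ k)) = ζ k := fun k => e.right_inv (hzt k)
  refine hres x hx r p A (fun k => 1 / (((k + n₀ : ℕ) : ℝ) + 1)) (fun k => e.symm (ζ (k + n₀)))
    (fun k => e.map_target (hzt _)) (fun k => s (k + n₀)) (fun k => hε _)
    (tendsto_one_div_add_atTop_nhds_zero_nat.comp hshift) (fun k => ?_) ?_ ?_ ?_
  · refine hu.jet_mem _ _ _ ⟨?_, ?_⟩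
    · have hsrc := e.map_target (hzt (k + n₀))
      have hnear : ∀ᶠ w in 𝓝 (e.symm (ζ (k + n₀))), e w ∈ Metric.ball (e (i x)) ρ := by
        refine (e.continuousAt hsrc).eventually (Metric.isOpen_ball.mem_nhds ?_)
        rw [hez]
        exact hn₀ _ (Nat.le_add_left _ _)
      filter_upwards [hnear, e.open_source.mem_nhds hsrc] with w hw hws
      have h1 := hmax (k + n₀) (e w) (Metric.ball_subset_closedBall hw)
      rw [Function.comp_apply, e.left_inv hws] at h1
      rw [quad_block_eq e _ w _ r p A x₀ y₀, hez]
      exact h1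
    · rw [quad]
      simpa using hs (k + n₀)
  · simp only [hez]
    exact ((continuous_fst.tendsto _).comp hζ).comp hshift
  · simp only [hez]
    have := (hpen.comp hshift).const_mul 2
    rw [mul_zero] at this
    refine this.congr fun k => ?_
    simp only [Function.comp_apply]
    ring
  · have := hslim.comp hshift
    simpa [hx₀, Function.comp_def] using this

/-- The jets of test functions for the restriction of `u` lie in the closure of the induced set. -/
theorem jet2_mem_closure_inducedJets {V : Type*} [NormedAddCommGroup V] [InnerProductSpace ℝ V]
    [FiniteDimensional ℝ E] [FiniteDimensional ℝ V] [IsManifold 𝓘(ℝ, E) ∞ X]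
    (hdim : Module.finrank ℝ E = Module.finrank ℝ V) {i : X → Z}
    (hemb : IsSmoothEmbedding 𝓘(ℝ, E) 𝓘(ℝ, E') ∞ i) {F : Set (JetBundle E' Z)}
    (hres : RestrictionHypothesis V W i hemb.contMDiff F) {u : Z → EReal} (hu : IsSubharmonic F u)
    {x : X} {φ : X → ℝ} (hφ : ContMDiffAt 𝓘(ℝ, E) 𝓘(ℝ, ℝ) 2 φ x)
    (htest : IsTestFunction (u ∘ i) φ x) :
    jet2 E φ x hφ ∈ fibre (closure (inducedJets i hemb.contMDiff F)) x := by
  have : ProperSpace V := FiniteDimensional.proper_real V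
  obtain ⟨e, y₀, he, hx, hresIn⟩ := hres x
  obtain ⟨L, hL⟩ := exists_sliceDerivative hdim (hemb.isImmersion.isImmersionAt x) he hx
  have hcoord : ContMDiffAt 𝓘(ℝ, E) 𝓘(ℝ, V) 2 (fun w => (e (i w)).1) x := by
    have h1 : ContMDiffAt 𝓘(ℝ, E) 𝓘(ℝ, V × W) ∞ (fun w => e (i w)) x :=
      (he.isCoordinates.contMDiffAt hx).comp x (hemb.contMDiff x)
    exact (contDiff_fst.contMDiff.contMDiffAt.comp x h1).of_le two_le_infty
  have hleft : (chartAt E x).symm (chartAt E x x) = x :=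
    (chartAt E x).left_inv (mem_chart_source E x)
  obtain ⟨p, A, hpA⟩ := exists_expansion (contDiffAt_comp_chartAt_symm hφ)
    (contDiffAt_comp_chartAt_symm hcoord) hL
  simp only [Function.comp_apply, hleft] at hpA
  let I : Sym2Form V := ⟨innerSL ℝ, fun v w => real_inner_comm w v⟩
  let ψ : X → ℝ := fun w => (1 / 2) * ‖(e (i w)).1 - (e (i x)).1‖ ^ 2
  have hψ : ContMDiffAt 𝓘(ℝ, E) 𝓘(ℝ, ℝ) 2 ψ x := by
    have h1 : ContDiff ℝ 2 fun v : V => (1 / 2) * ‖v - (e (i x)).1‖ ^ 2 :=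
      contDiff_const.mul ((contDiff_id.sub contDiff_const).norm_sq ℝ)
    exact h1.contMDiff.contMDiffAt.comp x hcoord
  have hslice : ∀ (t : ℝ) (w : X), sliceQuad i e x (φ x) p (A + t • I) w =
      sliceQuad i e x (φ x) p A w + t * ψ w := by
    intro t w
    have : I.1 ((e (i w)).1 - (e (i x)).1) ((e (i w)).1 - (e (i x)).1) =
        ‖(e (i w)).1 - (e (i x)).1‖ ^ 2 := real_inner_self_eq_norm_sq _
    simp only [sliceQuad, ψ, Submodule.coe_add, Submodule.coe_smul, add_apply, smul_apply,
      smul_eq_mul, this]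
    ring
  refine jet2_mem_closure hφ hψ fun t ht => ?_
  -- Adding t I to the second derivative adds (t/2)|x - x₀|² to the polynomial; hence the error is
  -- compared with the constant t/2.
  have hstrict : ∀ᶠ w in 𝓝 x, w ≠ x → u (i w) < sliceQuad i e x (φ x) p (A + t • I) w := by
    have h1 := eventually_lt_of_isLittleO hpA hL (half_pos ht)
    have h2 := eventually_chartAt_of_eventually (E := E) (P := fun v w => v ≠ chartAt E x x →
      φ w - sliceQuad i e x (φ x) p A w < t / 2 * ‖(e (i w)).1 - (e (i x)).1‖ ^ 2)
      (by simpa [sliceQuad, hleft] using h1)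
    filter_upwards [h2, htest.le, (chartAt E x).open_source.mem_nhds (mem_chart_source E x)]
      with w hw hle hws hwx
    have h3 := hw fun h => hwx ((chartAt E x).injOn hws (mem_chart_source E x) h)
    refine lt_of_le_of_lt hle ?_
    rw [EReal.coe_lt_coe_iff, hslice]
    simp only [ψ]
    linarith
  have hmem := jet2_sliceQuad_mem_of_strict hemb.contMDiff hemb.isEmbedding he hresIn hu hx
    htest.eq hstrict
  -- `φ + t ψ` has the same 2-jet as the perturbed polynomial, because φ and its expansion differ by
  -- o(|x - x₀|²).
  convert hmem using 1
  rw [jet2_eq_iff]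
  refine isLittleO_of_comp_chartAt_symm (hpA.congr_left fun v => ?_)
  simp only [Function.comp_apply, hslice]
  simp only [sliceQuad]
  ring

end Main

end ViscosityRestriction

theorem theorem9p1p1 {n m : ℕ}
    {X : Type*} [TopologicalSpace X] [ChartedSpace (EuclideanSpace ℝ (Fin n)) X]
    [IsManifold 𝓘(ℝ, EuclideanSpace ℝ (Fin n)) ∞ X]
    {Z : Type*} [TopologicalSpace Z] [ChartedSpace (EuclideanSpace ℝ (Fin (n + m))) Z]
    [IsManifold 𝓘(ℝ, EuclideanSpace ℝ (Fin (n + m))) ∞ Z]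
    (i : X → Z)
    (hi : IsSmoothEmbedding 𝓘(ℝ, EuclideanSpace ℝ (Fin n))
      𝓘(ℝ, EuclideanSpace ℝ (Fin (n + m))) ∞ i)
    (F : Set (ViscosityRestriction.JetBundle (EuclideanSpace ℝ (Fin (n + m))) Z))
    (hF : ViscosityRestriction.IsSubequation F)
    (hres : ViscosityRestriction.RestrictionHypothesis (EuclideanSpace ℝ (Fin n))
      (EuclideanSpace ℝ (Fin m)) i hi.contMDiff F)
    (u : Z → EReal) (hu : ViscosityRestriction.IsSubharmonic F u) :
    (IsClosed (ViscosityRestriction.inducedJets i hi.contMDiff F) →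
      ViscosityRestriction.IsSubharmonic
        (ViscosityRestriction.inducedJets i hi.contMDiff F) (u ∘ i)) ∧
    ViscosityRestriction.IsSubharmonic
      (closure (ViscosityRestriction.inducedJets i hi.contMDiff F)) (u ∘ i) := by

  have h : ViscosityRestriction.IsSubharmonic
      (closure (ViscosityRestriction.inducedJets i hi.contMDiff F)) (u ∘ i) :=
    ⟨⟨hu.usc.upperSemicontinuous.comp hi.contMDiff.continuous, fun x => hu.usc.lt_top (i x)⟩,
      fun _ _ hφ htest =>
        ViscosityRestriction.jet2_mem_closure_inducedJets rfl hi hres hu hφ htest⟩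
  exact ⟨fun hclosed => by rwa [hclosed.closure_eq] at h, h⟩
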